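/- **Theorem 7 (Exponential Sampling Formula).** Let $c\in\mathbb R$ and $T>0$. Let $\widetilde B^2_{c,T}$ be the space of all $f:\mathbb R^+\to\mathbb C$ with $x\mapsto f(x)x^{c-1/2}\in L^2(\mathbb R^+)$ for which $g(x):=x^cf(x)$ has an analytic extension to the Riemann surface of the logarithm, in the following sense. There are functions $g_k$ ($k\in\mathbb Z$), analytic on $\Omega=\mathbb C\setminus[0,\infty)$, such that: (i) for all $x>0$ and $k\in\mathbb Z$ the limits $g_k^{\pm}(x)=\lim_{\varepsilon\to0+}g_k(x\pm i\varepsilon)$ exist, $g_k^-(x)=g_{k+1}^+(x)$, and $g_0^+(x)=g(x)$; (ii) for every $k\in\mathbb Z$, every $x>0$ and every open disk $U$ with center $x$ contained in the right half-plane, the function on $U$ equal to $g_k(z)$ if $\Im z<0$, to $g_k^-(z)$ if $z\in\mathbb R$ and to $g_{k+1}(z)$ if $\Im z>0$ is analytic; (iii) there is $C>0$ such that $|g_k(re^{i\theta})|\le Ce^{T|2\pi k+\theta|}$ for all $k\in\mathbb Z$, $\theta\in[0,2\pi]$ and $r>0$; (iv) for every $k\in\mathbb Z$, $g_k(re^{i\theta})\to0$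 as $r\to0+$ and as $r\to\infty$, uniformly in $\theta\in[0,2\pi]$. In (iii) and (iv), $g_k(re^{i\theta})$ means $g_k^+(r)$ for $\theta=0$ and $g_k^-(r)$ for $\theta=2\pi$. For $a\in\mathbb R$ and $x>0$ put $\mathrm{lin}_a(x)=x^{-a}\,\mathrm{sinc}(\log x)$, where $\mathrm{sinc}(t)=\frac{\sin \pi t}{\pi t}$ for $t\ne0$ and $\mathrm{sinc}(0)=1$. If $\sigma>0$ and $f\in\widetilde B^2_{c,\pi\sigma}$, then the series $$x^c\sum_{k\in\mathbb Z} f(e^{k/\sigma})\,\mathrm{lin}_{c/\sigma}(e^{-k}x^\sigma)$$ converges uniformly on $\mathbb R^+$ (unconditionally, i.e. along the directed set of all finite subsets of $\mathbb Z$), and $$f(x)=\sum_{k\in\mathbb Z} f(e^{k/\sigma})\,\mathrm{lin}_{c/\sigma}(e^{-k}x^\sigma)\qquad(x\in\mathbb R^+).$$ -/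

import Mathlib

open Set Filter Topology MeasureTheory

noncomputable section

/-- Membership in the space `X_c^2`: functions `f : ℝ⁺ → ℂ` such that `x ↦ f(x) x^(c-1/2)` lies in
`L²(ℝ⁺)` for Lebesgue measure. A function on `ℝ⁺` is given by a function on `ℝ`, of which only the
values on `(0, ∞)` are used. -/
def MemX2 (c : ℝ) (f : ℝ → ℂ) : Prop :=
  MemLp (fun x : ℝ => f x * ((x ^ (c - 1 / 2) : ℝ) : ℂ)) 2 (volume.restrict (Ioi 0))

/-- The plane cut along the closed half-line `[0, ∞)`. -/
def cutPlane : Set ℂ := {z : ℂ | ¬ (0 ≤ z.re ∧ z.im = 0)}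

/-- The function that glues the branch `G k` below the positive half-line, the boundary values
`Gm k` (from below) on it, and the branch `G (k + 1)` above it. -/
def gluedBranch (G : ℤ → ℂ → ℂ) (Gm : ℤ → ℝ → ℂ) (k : ℤ) (z : ℂ) : ℂ :=
  if z.im < 0 then G k z else if z.im = 0 then Gm k z.re else G (k + 1) z

/-- An analytic function on the Riemann surface of the logarithm, given by its sheets: `G k` is its
holomorphic branch on the cut plane (argument between `2πk` and `2π(k+1)`), `Gp k` and `Gm k` are
the boundary values of `G k` on `(0, ∞)` from above and from below. The sheet `k` is glued to the
sheet `k + 1` holomorphically across the cut. -/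
structure IsLogSurfaceAnalytic (G : ℤ → ℂ → ℂ) (Gp Gm : ℤ → ℝ → ℂ) : Prop where
  holo : ∀ k : ℤ, DifferentiableOn ℂ (G k) cutPlane
  lim_above : ∀ k : ℤ, ∀ x : ℝ, 0 < x →
    Tendsto (fun ε : ℝ => G k ((x : ℂ) + (ε : ℂ) * Complex.I)) (𝓝[>] 0) (𝓝 (Gp k x))
  lim_below : ∀ k : ℤ, ∀ x : ℝ, 0 < x →
    Tendsto (fun ε : ℝ => G k ((x : ℂ) - (ε : ℂ) * Complex.I)) (𝓝[>] 0) (𝓝 (Gm k x))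
  match_sheets : ∀ k : ℤ, ∀ x : ℝ, 0 < x → Gm k x = Gp (k + 1) x
  glue : ∀ k : ℤ, ∀ x r : ℝ, 0 < r → r ≤ x →
    DifferentiableOn ℂ (gluedBranch G Gm k) (Metric.ball (x : ℂ) r)

/-- The value of the branch `k` at `r e^{iθ}`, `θ ∈ [0, 2π]`, understood as the boundary value from
above for `θ = 0` and from below for `θ = 2π`. -/
def branchValue (G : ℤ → ℂ → ℂ) (Gp Gm : ℤ → ℝ → ℂ) (k : ℤ) (r θ : ℝ) : ℂ :=
  if θ = 0 then Gp k r
  else if θ = 2 * Real.pi then Gm k r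
  else G k ((r : ℂ) * Complex.exp ((θ : ℂ) * Complex.I))

/-- Membership in the Mellin-Bernstein space `B̃^2_{c,T}`. -/
def MemMellinBernstein (c T : ℝ) (f : ℝ → ℂ) : Prop :=
  MemX2 c f ∧
  ∃ (G : ℤ → ℂ → ℂ) (Gp Gm : ℤ → ℝ → ℂ),
    IsLogSurfaceAnalytic G Gp Gm ∧
    (∀ x : ℝ, 0 < x → Gp 0 x = ((x ^ c : ℝ) : ℂ) * f x) ∧
    (∃ C : ℝ, 0 < C ∧ ∀ k : ℤ, ∀ θ ∈ Icc (0 : ℝ) (2 * Real.pi), ∀ r : ℝ, 0 < r →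
      ‖branchValue G Gp Gm k r θ‖ ≤ C * Real.exp (T * |2 * Real.pi * (k : ℝ) + θ|)) ∧
    (∀ k : ℤ,
      TendstoUniformlyOn (fun r θ : ℝ => branchValue G Gp Gm k r θ) (fun _ => 0) (𝓝[>] 0)
        (Icc 0 (2 * Real.pi)) ∧
      TendstoUniformlyOn (fun r θ : ℝ => branchValue G Gp Gm k r θ) (fun _ => 0) atTop
        (Icc 0 (2 * Real.pi)))

/-- The function `lin_c(x) = x^{-c} sinc(log x)` on `ℝ⁺`, with the normalized
`sinc t = sin(πt)/(πt)`, `sinc 0 = 1` (`Real.sinc` is the unnormalized function). -/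
def mellinLin (c x : ℝ) : ℝ := x ^ (-c) * Real.sinc (Real.pi * Real.log x)

end

/-! In the coordinate `w = log x` the sheets of `g` glue to one entire function `F` with `‖F w‖ ≤ C
e^{πσ|Im w|}`, and `H z = F (z / σ)` has type `π`. After multiplication by `x^c` the series is the
classical cardinal series of `H` at the point `σ log x`, so the theorem reduces to
`eq_tsum_complexSinc`.

That lemma avoids Fourier analysis. With square summable samples the series converges uniformly on
horizontal strips, by Cauchy–Schwarz, to an entire function of type `π` with the same values at the
integers. The difference divided by `sin (π z)` is entire and bounded, hence constant by Liouville;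
both functions tend to `0` at `+∞`, so the constant is `0`.

Square summability of the samples comes from the `L²` condition through
`summable_norm_sq_int_of_lintegral`. Some translate of the integers carries square summable samples,
and oversampling transfers this to the integers themselves. Oversampling needs type `π / 2`, so it
is applied to `H (z / 2)`. -/

/-! ### The cardinal sine and its growth -/

/-- The normalized cardinal sine `sin (π z) / (π z)` as an entire function. -/
noncomputable def complexSinc (z : ℂ) : ℂ := dslope Complex.sin 0 (Real.pi * z)

@[simp] lemma complexSinc_zero : complexSinc 0 = 1 := by
  simp [complexSinc]

lemma complexSinc_of_ne_zero {z : ℂ} (hz : z ≠ 0) :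
    complexSinc z = Complex.sin (Real.pi * z) / (Real.pi * z) := by
  have h : (Real.pi : ℂ) * z ≠ 0 := mul_ne_zero (by exact_mod_cast Real.pi_ne_zero) hz
  rw [complexSinc, dslope_of_ne _ h, slope_def_field]
  simp

lemma complexSinc_ofReal (x : ℝ) : complexSinc x = (Real.sinc (Real.pi * x) : ℝ) := by
  rcases eq_or_ne x 0 with rfl | hx
  · simp
  · rw [complexSinc_of_ne_zero (by exact_mod_cast hx),
      Real.sinc_of_ne_zero (mul_ne_zero Real.pi_ne_zero hx)]
    push_cast
    rfl

lemma complexSinc_intCast {n : ℤ} (hn : n ≠ 0) : complexSinc n = 0 := by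
  rw [complexSinc_of_ne_zero (by exact_mod_cast hn), mul_comm, Complex.sin_int_mul_pi, zero_div]

lemma differentiable_complexSinc : Differentiable ℂ complexSinc := by
  have h : Differentiable ℂ (dslope Complex.sin 0) := by
    rw [← differentiableOn_univ, Complex.differentiableOn_dslope univ_mem]
    exact Complex.differentiable_sin.differentiableOn
  exact h.comp (differentiable_id.const_mul _)

lemma norm_sin_le_exp_abs_im (z : ℂ) : ‖Complex.sin z‖ ≤ Real.exp |z.im| := by
  have h1 : ‖Complex.exp (-z * Complex.I)‖ ≤ Real.exp |z.im| := by
    rw [Complex.norm_exp]; simpa using le_abs_self z.im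
  have h2 : ‖Complex.exp (z * Complex.I)‖ ≤ Real.exp |z.im| := by
    rw [Complex.norm_exp]; simpa using neg_le_abs z.im
  rw [Complex.sin, norm_div, norm_mul, Complex.norm_I, mul_one]
  have := norm_sub_le (Complex.exp (-z * Complex.I)) (Complex.exp (z * Complex.I))
  simp only [Complex.norm_ofNat]
  linarith

lemma exp_abs_im_sub_le_norm_sin (z : ℂ) :
    (Real.exp |z.im| - Real.exp (-|z.im|)) / 2 ≤ ‖Complex.sin z‖ := by
  have h1 : ‖Complex.exp (-z * Complex.I)‖ = Real.exp z.im := by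
    rw [Complex.norm_exp]; simp
  have h2 : ‖Complex.exp (z * Complex.I)‖ = Real.exp (-z.im) := by
    rw [Complex.norm_exp]; simp
  rw [Complex.sin, norm_div, norm_mul, Complex.norm_I, mul_one]
  have := abs_norm_sub_norm_le (Complex.exp (-z * Complex.I)) (Complex.exp (z * Complex.I))
  rw [h1, h2] at this
  simp only [Complex.norm_ofNat]
  have h3 : Real.exp |z.im| - Real.exp (-|z.im|) ≤ |Real.exp z.im - Real.exp (-z.im)| := by
    rcases abs_cases z.im with ⟨h, _⟩ | ⟨h, _⟩ <;> rw [h]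
    · exact le_abs_self _
    · rw [neg_neg]; have := neg_le_abs (Real.exp z.im - Real.exp (-z.im)); linarith
  linarith

lemma abs_im_pi_mul (z : ℂ) : |((Real.pi : ℂ) * z).im| = Real.pi * |z.im| := by
  rw [Complex.im_ofReal_mul, abs_mul, abs_of_pos Real.pi_pos]

/-- Compactness handles the unit disk; outside it `1 + ‖z‖ ≤ π ‖z‖`. The denominator makes integer
translates square summable, the exponential records type `π`. -/
lemma exists_norm_complexSinc_le :
    ∃ K : ℝ, 0 < K ∧ ∀ z : ℂ, ‖complexSinc z‖ ≤ K * Real.exp (Real.pi * |z.im|) / (1 + ‖z‖) := by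
  obtain ⟨M, hM⟩ := (isCompact_closedBall (0 : ℂ) 1).exists_bound_of_continuousOn
    differentiable_complexSinc.continuous.continuousOn
  refine ⟨max (2 * M) 1, by positivity, fun z => ?_⟩
  rw [le_div_iff₀ (by positivity)]
  have he : 1 ≤ Real.exp (Real.pi * |z.im|) := Real.one_le_exp (by positivity)
  rcases le_total ‖z‖ 1 with hz | hz
  · have h := hM z (by simpa using hz)
    have h0 := norm_nonneg (complexSinc z)
    calc ‖complexSinc z‖ * (1 + ‖z‖) ≤ M * 2 :=
          mul_le_mul h (by linarith) (by positivity) (h0.trans h)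
      _ ≤ max (2 * M) 1 * 1 := by rw [mul_one, mul_comm]; exact le_max_left _ _
      _ ≤ _ := by gcongr
  · have hz0 : z ≠ 0 := by rintro rfl; simp at hz; linarith
    have h := norm_sin_le_exp_abs_im (Real.pi * z)
    rw [abs_im_pi_mul] at h
    rw [complexSinc_of_ne_zero hz0, norm_div, norm_mul, Complex.norm_real,
      Real.norm_of_nonneg Real.pi_pos.le]
    have hpi := Real.pi_gt_three
    calc ‖Complex.sin (Real.pi * z)‖ / (Real.pi * ‖z‖) * (1 + ‖z‖)
        = ‖Complex.sin (Real.pi * z)‖ * ((1 + ‖z‖) / (Real.pi * ‖z‖)) := by ring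
      _ ≤ ‖Complex.sin (Real.pi * z)‖ * 1 := by
        gcongr
        rw [div_le_one (by positivity)]
        nlinarith
      _ ≤ 1 * Real.exp (Real.pi * |z.im|) := by linarith
      _ ≤ _ := by gcongr; exact le_max_right _ _

/-- Shifting the index by `round x` compares every `x` with `0` at the cost of a factor `4`, so the
bound is uniform in `x`. -/
lemma exists_sum_inv_sq_le :
    ∃ M : ℝ, 0 < M ∧ ∀ (x : ℝ) (s : Finset ℤ), ∑ k ∈ s, (1 / (1 + |x - k|)) ^ 2 ≤ M := by
  have hs : Summable fun k : ℤ => (1 / (1 + |(k : ℝ)|)) ^ 2 := by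
    refine Summable.of_norm_bounded_eventually (Real.summable_one_div_int_pow.mpr one_lt_two) ?_
    filter_upwards [(Set.finite_singleton (0 : ℤ)).compl_mem_cofinite] with k hk
    have hk : (k : ℝ) ≠ 0 := by exact_mod_cast hk
    have : 0 < |(k : ℝ)| := abs_pos.mpr hk
    rw [Real.norm_of_nonneg (by positivity), ← sq_abs (k : ℝ), ← one_div_pow]
    gcongr
    linarith
  refine ⟨4 * ∑' k : ℤ, (1 / (1 + |(k : ℝ)|)) ^ 2 + 1, by positivity, fun x s => ?_⟩
  have key : ∀ k : ℤ, (1 / (1 + |x - k|)) ^ 2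
      ≤ 4 * (1 / (1 + |((k - round x : ℤ) : ℝ)|)) ^ 2 := by
    intro k
    have h1 := abs_sub_round x
    have h2 : |((k - round x : ℤ) : ℝ)| ≤ |x - k| + 1 / 2 := by
      push_cast
      calc |(k : ℝ) - round x| = |(x - round x) - (x - k)| := by ring_nf
        _ ≤ |x - round x| + |x - k| := abs_sub _ _
        _ ≤ _ := by linarith
    have h3 : 1 / (1 + |x - k|) ≤ 2 * (1 / (1 + |((k - round x : ℤ) : ℝ)|)) := by
      rw [mul_one_div, div_le_div_iff₀ (by positivity) (by positivity)]
      have := abs_nonneg (x - k)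
      linarith
    calc (1 / (1 + |x - k|)) ^ 2 ≤ (2 * (1 / (1 + |((k - round x : ℤ) : ℝ)|))) ^ 2 := by gcongr
      _ = _ := by ring
  calc ∑ k ∈ s, (1 / (1 + |x - k|)) ^ 2
      ≤ ∑ k ∈ s, 4 * (1 / (1 + |((k - round x : ℤ) : ℝ)|)) ^ 2 :=
        Finset.sum_le_sum fun k _ => key k
    _ ≤ ∑' k : ℤ, 4 * (1 / (1 + |((k - round x : ℤ) : ℝ)|)) ^ 2 :=
        Summable.sum_le_tsum s (fun _ _ => by positivity)
          (((Equiv.subRight (round x)).summable_iff.mpr hs).mul_left 4)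
    _ = 4 * ∑' k : ℤ, (1 / (1 + |(k : ℝ)|)) ^ 2 := by
        rw [tsum_mul_left]
        congr 1
        exact (Equiv.subRight (round x)).tsum_eq fun k : ℤ => (1 / (1 + |(k : ℝ)|)) ^ 2
    _ ≤ _ := by linarith

/-! ### Cardinal series with square summable coefficients -/

lemma exists_norm_sum_mul_complexSinc_le :
    ∃ M : ℝ, 0 < M ∧ ∀ (a : ℤ → ℂ) (s : Finset ℤ) (z : ℂ),
      ‖∑ k ∈ s, a k * complexSinc (z - k)‖
        ≤ M * Real.exp (Real.pi * |z.im|) * √(∑ k ∈ s, ‖a k‖ ^ 2) := by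
  obtain ⟨K, hK, hKb⟩ := exists_norm_complexSinc_le
  obtain ⟨M, hM, hMb⟩ := exists_sum_inv_sq_le
  refine ⟨K * √M, by positivity, fun a s z => ?_⟩
  have h1 : ∀ k : ℤ, ‖complexSinc (z - k)‖
      ≤ K * Real.exp (Real.pi * |z.im|) * (1 / (1 + |z.re - k|)) := by
    intro k
    refine (hKb _).trans ?_
    rw [mul_one_div]
    have h := Complex.abs_re_le_norm (z - k)
    simp only [Complex.sub_re, Complex.intCast_re] at h
    simp only [Complex.sub_im, Complex.intCast_im, sub_zero]
    gcongr
  calc ‖∑ k ∈ s, a k * complexSinc (z - k)‖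
      ≤ ∑ k ∈ s, ‖a k‖ * (K * Real.exp (Real.pi * |z.im|) * (1 / (1 + |z.re - k|))) := by
        refine norm_sum_le_of_le _ fun k _ => ?_
        rw [norm_mul]
        exact mul_le_mul_of_nonneg_left (h1 k) (norm_nonneg _)
    _ = K * Real.exp (Real.pi * |z.im|) * ∑ k ∈ s, ‖a k‖ * (1 / (1 + |z.re - k|)) := by
        rw [Finset.mul_sum]
        exact Finset.sum_congr rfl fun k _ => by ring
    _ ≤ K * Real.exp (Real.pi * |z.im|)
          * (√(∑ k ∈ s, ‖a k‖ ^ 2) * √(∑ k ∈ s, (1 / (1 + |z.re - k|)) ^ 2)) := by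
        gcongr
        exact Real.sum_mul_le_sqrt_mul_sqrt _ _ _
    _ ≤ K * Real.exp (Real.pi * |z.im|) * (√(∑ k ∈ s, ‖a k‖ ^ 2) * √M) := by
        gcongr
        exact hMb _ _
    _ = _ := by ring

lemma summable_mul_complexSinc {a : ℤ → ℂ} (ha : Summable fun k => ‖a k‖ ^ 2) (z : ℂ) :
    Summable fun k : ℤ => a k * complexSinc (z - k) := by
  obtain ⟨M, hM, hMb⟩ := exists_norm_sum_mul_complexSinc_le
  rw [summable_iff_vanishing_norm]
  intro ε hε
  set E := M * Real.exp (Real.pi * |z.im|) with hE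
  have hEpos : 0 < E := by positivity
  obtain ⟨s, hs⟩ := summable_iff_vanishing_norm.mp ha ((ε / E) ^ 2) (by positivity)
  refine ⟨s, fun t ht => (hMb a t z).trans_lt ?_⟩
  have h := hs t ht
  rw [Real.norm_of_nonneg (by positivity)] at h
  rw [← hE, mul_comm, ← lt_div_iff₀ hEpos, Real.sqrt_lt' (by positivity)]
  exact h

/-- Passage to the limit in the finite bound over `t \ s`. The case `s = ∅` gives the growth of the
sum, general `s` its uniform convergence on strips. -/
lemma exists_norm_tsum_sub_sum_complexSinc_le :
    ∃ M : ℝ, 0 < M ∧ ∀ (a : ℤ → ℂ), (Summable fun k => ‖a k‖ ^ 2) → ∀ (s : Finset ℤ) (z : ℂ),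
      ‖∑' k, a k * complexSinc (z - k) - ∑ k ∈ s, a k * complexSinc (z - k)‖
        ≤ M * Real.exp (Real.pi * |z.im|) * √(∑' k, ‖a k‖ ^ 2 - ∑ k ∈ s, ‖a k‖ ^ 2) := by
  obtain ⟨M, hM, hMb⟩ := exists_norm_sum_mul_complexSinc_le
  refine ⟨M, hM, fun a ha s z => ?_⟩
  have h1 := ((summable_mul_complexSinc ha z).hasSum.sub_const
    (∑ k ∈ s, a k * complexSinc (z - k))).norm
  refine le_of_tendsto h1 ?_
  filter_upwards [eventually_ge_atTop s] with t ht
  classical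
  rw [← Finset.sum_sdiff ht, add_sub_cancel_right]
  refine (hMb a _ z).trans ?_
  gcongr
  have h2 := Finset.sum_sdiff ht (f := fun k => ‖a k‖ ^ 2)
  have h3 := ha.sum_le_tsum t (fun _ _ => by positivity)
  linarith

lemma tendstoUniformlyOn_sum_complexSinc {a : ℤ → ℂ} (ha : Summable fun k => ‖a k‖ ^ 2) (R : ℝ) :
    TendstoUniformlyOn (fun (s : Finset ℤ) (z : ℂ) => ∑ k ∈ s, a k * complexSinc (z - k))
      (fun z => ∑' k, a k * complexSinc (z - k)) atTop {z : ℂ | |z.im| < R} := by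
  obtain ⟨M, hM, hMb⟩ := exists_norm_tsum_sub_sum_complexSinc_le
  rw [Metric.tendstoUniformlyOn_iff]
  intro ε hε
  have h1 : Tendsto (fun s : Finset ℤ => M * Real.exp (Real.pi * R)
      * √(∑' k, ‖a k‖ ^ 2 - ∑ k ∈ s, ‖a k‖ ^ 2)) atTop (𝓝 0) := by
    have := ((ha.hasSum.const_sub (∑' k, ‖a k‖ ^ 2)).sqrt).const_mul (M * Real.exp (Real.pi * R))
    simpa using this
  filter_upwards [h1.eventually_lt_const hε] with s hs z hz
  rw [dist_eq_norm]
  refine ((hMb a ha s z).trans ?_).trans_lt hs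
  have hz : |z.im| < R := hz
  have := Real.pi_pos
  gcongr

lemma differentiable_tsum_complexSinc {a : ℤ → ℂ} (ha : Summable fun k => ‖a k‖ ^ 2) :
    Differentiable ℂ fun z => ∑' k, a k * complexSinc (z - k) := by
  intro z
  have ho : IsOpen {w : ℂ | |w.im| < |z.im| + 1} :=
    isOpen_lt (continuous_abs.comp Complex.continuous_im) continuous_const
  have h := (tendstoUniformlyOn_sum_complexSinc ha (|z.im| + 1)).tendstoLocallyUniformlyOn
  refine (h.differentiableOn (Eventually.of_forall fun s => ?_) ho).differentiableAt
    (ho.mem_nhds (by simp))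
  refine Differentiable.differentiableOn (Differentiable.fun_sum fun k _ => ?_)
  exact (differentiable_complexSinc.comp (differentiable_id.sub_const _)).const_mul _

lemma tendsto_complexSinc_atTop : Tendsto (fun x : ℝ => complexSinc x) atTop (𝓝 0) := by
  obtain ⟨K, hK, hKb⟩ := exists_norm_complexSinc_le
  have h : Tendsto (fun x : ℝ => K / (1 + x)) atTop (𝓝 0) :=
    tendsto_const_nhds.div_atTop (tendsto_atTop_add_const_left _ _ tendsto_id)
  refine squeeze_zero_norm' ?_ h
  filter_upwards [eventually_ge_atTop 0] with x hx
  simpa [abs_of_nonneg hx] using hKb x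

lemma tendsto_tsum_complexSinc_atTop {a : ℤ → ℂ} (ha : Summable fun k => ‖a k‖ ^ 2) :
    Tendsto (fun x : ℝ => ∑' k, a k * complexSinc (x - k)) atTop (𝓝 0) := by
  rw [Metric.tendsto_nhds]
  intro ε hε
  obtain ⟨s, hs⟩ := ((Metric.tendstoUniformlyOn_iff.mp
    (tendstoUniformlyOn_sum_complexSinc ha 1)) (ε / 2) (by positivity)).exists
  have h1 : Tendsto (fun x : ℝ => ∑ k ∈ s, a k * complexSinc (x - k)) atTop (𝓝 0) := by
    rw [← Finset.sum_const_zero (s := s)]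
    refine tendsto_finsetSum _ fun k _ => ?_
    have h2 := (tendsto_complexSinc_atTop.comp
      (tendsto_atTop_add_const_right atTop (-(k : ℝ)) tendsto_id)).const_mul (a k)
    simpa [Function.comp_def, sub_eq_add_neg] using h2
  filter_upwards [(Metric.tendsto_nhds.mp h1) (ε / 2) (by positivity)] with x hx
  have h3 := hs x (by simp)
  have := dist_triangle (∑' k, a k * complexSinc (x - k))
    (∑ k ∈ s, a k * complexSinc (x - k)) 0
  linarith

/-! ### Uniqueness and the cardinal series expansion -/

/-- Near a zero `z` of `g`, cancelling `w - z` turns `f / g` into a quotient of `dslope`s whose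
denominator does not vanish there. -/
lemma exists_entire_quotient {f g : ℂ → ℂ} (hf : Differentiable ℂ f) (hg : Differentiable ℂ g)
    (hsimple : ∀ z, g z = 0 → deriv g z ≠ 0) (hzero : ∀ z, g z = 0 → f z = 0) :
    ∃ q : ℂ → ℂ, Differentiable ℂ q ∧ ∀ z, f z = q z * g z := by
  have hds : ∀ {h : ℂ → ℂ}, Differentiable ℂ h → ∀ w, Differentiable ℂ (dslope h w) := by
    intro h hh w
    rw [← differentiableOn_univ, Complex.differentiableOn_dslope univ_mem]
    exact hh.differentiableOn
  classical
  refine ⟨fun z => if g z = 0 then deriv f z / deriv g z else f z / g z, fun z => ?_, fun z => ?_⟩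
  · by_cases hz : g z = 0
    · have h0 : dslope g z z ≠ 0 := by rw [dslope_same]; exact hsimple z hz
      have hev : ∀ᶠ w in 𝓝 z, dslope g z w ≠ 0 :=
        (hds hg z).continuous.continuousAt.eventually_ne h0
      refine DifferentiableAt.congr_of_eventuallyEq
        (((hds hf z) z).fun_div ((hds hg z) z) h0) ?_
      filter_upwards [hev] with w hw
      rcases eq_or_ne w z with rfl | hne
      · simp [hz]
      · rw [dslope_of_ne _ hne, slope_def_field, hz, sub_zero] at hw
        have hgw : g w ≠ 0 := fun h => hw (by rw [h, zero_div])
        rw [if_neg hgw, dslope_of_ne _ hne, dslope_of_ne _ hne, slope_def_field, slope_def_field,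
          hz, hzero z hz, sub_zero, sub_zero, div_div_div_cancel_right₀ (sub_ne_zero.mpr hne)]
    · refine DifferentiableAt.congr_of_eventuallyEq ((hf z).fun_div (hg z) hz) ?_
      filter_upwards [hg.continuous.continuousAt.eventually_ne hz] with w hw
      rw [if_neg hw]
  · by_cases hz : g z = 0
    · simp [hz, hzero z hz]
    · simp [hz]

lemma exp_le_four_mul_norm_sin_of_one_le_abs_im {z : ℂ} (hz : 1 ≤ |z.im|) :
    Real.exp (Real.pi * |z.im|) ≤ 4 * ‖Complex.sin (Real.pi * z)‖ := by
  have h := exp_abs_im_sub_le_norm_sin (Real.pi * z)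
  rw [abs_im_pi_mul] at h
  have hpi : 3 ≤ Real.pi * |z.im| := by nlinarith [Real.pi_gt_three]
  have h1 : 2 ≤ Real.exp (Real.pi * |z.im|) := by
    linarith [Real.add_one_le_exp (Real.pi * |z.im|)]
  have h2 : Real.exp (-(Real.pi * |z.im|)) ≤ 1 := Real.exp_le_one_iff.mpr (by linarith)
  linarith

lemma exp_le_four_mul_norm_sin_of_re_eq {z : ℂ} {n : ℤ} (hz : z.re = n + 1 / 2) :
    Real.exp (Real.pi * |z.im|) ≤ 4 * ‖Complex.sin (Real.pi * z)‖ := by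
  have h1 : (Real.pi : ℂ) * z = ((Real.pi * z.im : ℝ) : ℂ) * Complex.I + Real.pi / 2
      + n * Real.pi := by
    apply Complex.ext
    · simp [hz]; ring
    · simp
  have h2 : ‖Complex.sin (Real.pi * z)‖ = Real.cosh (Real.pi * z.im) := by
    rw [h1, Complex.sin_antiperiodic.add_int_mul_eq, Complex.sin_add_pi_div_two, Complex.cos_mul_I,
      ← Complex.ofReal_cosh, norm_mul, Complex.norm_real, Real.norm_of_nonneg (Real.cosh_pos _).le]
    rcases Int.units_eq_one_or n.negOnePow with h | h <;> simp [h]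
  rw [h2, ← Real.cosh_abs, abs_mul, abs_of_pos Real.pi_pos, Real.cosh_eq]
  have := Real.exp_pos (-(Real.pi * |z.im|))
  have := Real.exp_pos (Real.pi * |z.im|)
  linarith

/-- An entire function of exponential type `π`, bounded on the real line, that vanishes at the
integers is a multiple of `sin (π z)`. -/
lemma exists_eq_mul_sin_of_forall_int_eq_zero {f : ℂ → ℂ} (hf : Differentiable ℂ f) {C : ℝ}
    (hC : ∀ z, ‖f z‖ ≤ C * Real.exp (Real.pi * |z.im|)) (hzero : ∀ n : ℤ, f n = 0) :
    ∃ A : ℂ, ∀ z, f z = A * Complex.sin (Real.pi * z) := by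
  have hpi : (Real.pi : ℂ) ≠ 0 := by exact_mod_cast Real.pi_ne_zero
  have hg : Differentiable ℂ fun z : ℂ => Complex.sin (Real.pi * z) :=
    Complex.differentiable_sin.comp (differentiable_id.const_mul _)
  have hgz : ∀ z : ℂ, Complex.sin (Real.pi * z) = 0 → ∃ n : ℤ, z = n := by
    intro z hz
    obtain ⟨k, hk⟩ := Complex.sin_eq_zero_iff.mp hz
    exact ⟨k, mul_left_cancel₀ hpi (by rw [hk, mul_comm])⟩
  obtain ⟨q, hq, hfq⟩ := exists_entire_quotient hf hg
    (fun z hz => by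
      have hd : HasDerivAt (fun z : ℂ => Complex.sin (Real.pi * z))
          (Complex.cos (Real.pi * z) * (Real.pi * 1)) z :=
        ((hasDerivAt_id z).const_mul (Real.pi : ℂ)).csin
      rw [hd.deriv]
      have h1 := Complex.sin_sq_add_cos_sq (Real.pi * z)
      rw [hz] at h1
      refine mul_ne_zero (fun h => ?_) (by simp)
      rw [h] at h1
      norm_num at h1)
    (fun z hz => by obtain ⟨n, rfl⟩ := hgz z hz; exact hzero n)
  have hC0 : 0 ≤ C := by simpa using (norm_nonneg _).trans (hC 0)
  have hbd : ∀ z : ℂ, Real.exp (Real.pi * |z.im|) ≤ 4 * ‖Complex.sin (Real.pi * z)‖ →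
      ‖q z‖ ≤ 4 * C := by
    intro z hz
    have h1 := hC z
    rw [hfq, norm_mul] at h1
    have h2 : 0 < ‖Complex.sin (Real.pi * z)‖ := by
      linarith [Real.exp_pos (Real.pi * |z.im|)]
    refine le_of_mul_le_mul_right (h1.trans ?_) h2
    calc C * Real.exp (Real.pi * |z.im|) ≤ C * (4 * ‖Complex.sin (Real.pi * z)‖) := by gcongr
      _ = _ := by ring
  have hall : ∀ z : ℂ, ‖q z‖ ≤ 4 * C := by
    intro z
    by_cases hz : 1 ≤ |z.im|
    · exact hbd z (exp_le_four_mul_norm_sin_of_one_le_abs_im hz)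
    push Not at hz
    -- Maximum principle on a box around the nearest integer: its sides lie on `|Im| = 1` and on
    -- half-integer abscissae, where `sin` is bounded below. Rounding may put `z` on a side, hence
    -- the closure.
    set n := round z.re with hn
    have hround := abs_le.mp (abs_sub_round z.re)
    have hlt : (n : ℝ) - 1 / 2 < n + 1 / 2 := by linarith
    set U : Set ℂ := Ioo ((n : ℝ) - 1 / 2) (n + 1 / 2) ×ℂ Ioo (-1 : ℝ) 1 with hU
    have hUb : Bornology.IsBounded U :=
      (Metric.isBounded_Ioo _ _).reProdIm (Metric.isBounded_Ioo _ _)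
    have hcl : z ∈ closure U := by
      rw [hU, Complex.closure_reProdIm, closure_Ioo hlt.ne, closure_Ioo (by norm_num)]
      obtain ⟨h1, h2⟩ := abs_lt.mp hz
      exact ⟨⟨by linarith, by linarith⟩, h1.le, h2.le⟩
    refine Complex.norm_le_of_forall_mem_frontier_norm_le hUb hq.diffContOnCl (fun w hw => ?_) hcl
    rw [hU, Complex.frontier_reProdIm, frontier_Ioo hlt, frontier_Ioo (by norm_num)] at hw
    rcases hw with ⟨-, hw⟩ | ⟨hw, -⟩
    · refine hbd w (exp_le_four_mul_norm_sin_of_one_le_abs_im ?_)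
      rcases hw with hw | hw
      · rw [hw]; norm_num
      · rw [mem_singleton_iff.mp hw]; norm_num
    · rcases hw with hw | hw
      · exact hbd w (exp_le_four_mul_norm_sin_of_re_eq (n := n - 1)
          (by rw [hw]; push_cast; ring))
      · exact hbd w (exp_le_four_mul_norm_sin_of_re_eq (mem_singleton_iff.mp hw))
  refine ⟨q 0, fun z => ?_⟩
  rw [hfq z, hq.apply_eq_apply_of_bounded
    (isBounded_iff_forall_norm_le.mpr ⟨4 * C, by rintro _ ⟨w, rfl⟩; exact hall w⟩) z 0]

/-- The cardinal series of an entire function of exponential type `π` with square summable samples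
at the integers, bounded on the real line and vanishing at infinity there. -/
lemma eq_tsum_complexSinc {f : ℂ → ℂ} (hf : Differentiable ℂ f) {C : ℝ}
    (hC : ∀ z, ‖f z‖ ≤ C * Real.exp (Real.pi * |z.im|))
    (hsum : Summable fun k : ℤ => ‖f k‖ ^ 2) (hlim : Tendsto (fun x : ℝ => f x) atTop (𝓝 0))
    (z : ℂ) : f z = ∑' k : ℤ, f k * complexSinc (z - k) := by
  obtain ⟨M, hM, hMb⟩ := exists_norm_tsum_sub_sum_complexSinc_le
  have hS := differentiable_tsum_complexSinc hsum
  have hb : ∀ z, ‖f z - ∑' k : ℤ, f k * complexSinc (z - k)‖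
      ≤ (C + M * √(∑' k : ℤ, ‖f k‖ ^ 2)) * Real.exp (Real.pi * |z.im|) := by
    intro z
    have h1 := hMb _ hsum ∅ z
    simp only [Finset.sum_empty, sub_zero] at h1
    calc _ ≤ _ := norm_sub_le _ _
      _ ≤ _ := add_le_add (hC z) h1
      _ = _ := by ring
  have hz : ∀ n : ℤ, f n - ∑' k : ℤ, f k * complexSinc (n - k) = 0 := by
    intro n
    rw [tsum_eq_single n, sub_self, complexSinc_zero, mul_one, sub_self]
    intro k hk
    rw [← Int.cast_sub, complexSinc_intCast (sub_ne_zero.mpr hk.symm), mul_zero]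
  obtain ⟨A, hA⟩ := exists_eq_mul_sin_of_forall_int_eq_zero (hf.sub hS) hb hz
  have hA' : ∀ z, f z - ∑' k : ℤ, f k * complexSinc (z - k) = A * Complex.sin (Real.pi * z) := hA
  have h0 : A = 0 := by
    have h1 := hlim.sub (tendsto_tsum_complexSinc_atTop hsum)
    rw [sub_zero] at h1
    -- At the points `2m + 1/2` the sine equals `1`, so the difference is constantly `A` along a
    -- sequence where it tends to `0`.
    have h2 : Tendsto (fun m : ℕ => 2 * (m : ℝ) + 1 / 2) atTop atTop :=
      tendsto_atTop_add_const_right _ _ (tendsto_natCast_atTop_atTop.const_mul_atTop two_pos)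
    have h3 := h1.comp h2
    refine tendsto_nhds_unique (tendsto_const_nhds.congr fun m => ?_) h3
    rw [Function.comp_apply, hA']
    have : (Real.pi : ℂ) * ((2 * (m : ℝ) + 1 / 2 : ℝ) : ℂ)
        = Real.pi / 2 + m * (2 * Real.pi) := by push_cast; ring
    rw [this, Complex.sin_add_nat_mul_two_pi, Complex.sin_pi_div_two, mul_one]
  have := hA' z
  rw [h0, zero_mul, sub_eq_zero] at this
  exact this

/-! ### Square summability of the samples -/

/-- By Tonelli the periodization of `φ` has the same integral over `(0, 1]` as `φ` over the line, so
it is finite almost everywhere. -/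
lemma exists_tsum_translate_ne_top {φ : ℝ → ENNReal} (hφ : Measurable φ)
    (hint : ∫⁻ t, φ t ≠ ⊤) : ∃ b : ℝ, ∑' k : ℤ, φ (k + b) ≠ ⊤ := by
  have hmk : ∀ k : ℤ, Measurable fun t => φ (k + t) := fun k => hφ.comp (measurable_const_add _)
  have h1 : ∫⁻ t in Ioc (0 : ℝ) 1, ∑' k : ℤ, φ (k + t) = ∫⁻ t, φ t := by
    rw [lintegral_tsum fun k => (hmk k).aemeasurable,
      ← setLIntegral_univ φ, ← iUnion_Ioc_intCast ℝ,
      lintegral_iUnion (fun _ => measurableSet_Ioc) (pairwise_disjoint_Ioc_intCast ℝ)]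
    refine tsum_congr fun k => ?_
    have h2 := (measurePreserving_add_left volume (k : ℝ)).setLIntegral_comp_preimage
      (measurableSet_Ioc (a := (k : ℝ)) (b := k + 1)) hφ
    rw [← h2]
    congr 3
    simp
  rw [← h1] at hint
  have hm : Measurable fun t => ∑' k : ℤ, φ (k + t) := Measurable.tsum hmk
  have hae := ae_lt_top hm hint
  have hne : (volume.restrict (Ioc (0 : ℝ) 1)) ≠ 0 := by
    simp [Measure.restrict_eq_zero]
  have : (ae (volume.restrict (Ioc (0 : ℝ) 1))).NeBot := ae_neBot.mpr hne
  obtain ⟨b, hb⟩ := hae.exists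
  exact ⟨b, hb.ne⟩

/-- Kernel form of oversampling: an entire function of exponential type `π / 2` is reproduced from
its samples at `k + b` by an absolutely summable kernel. -/
lemma exists_norm_le_of_oversampling : ∃ K : ℝ, 0 < K ∧ ∀ {f : ℂ → ℂ}, Differentiable ℂ f →
    ∀ {C : ℝ}, (∀ z, ‖f z‖ ≤ C * Real.exp (Real.pi / 2 * |z.im|)) → ∀ b : ℝ,
      (Summable fun k : ℤ => ‖f (k + b)‖ ^ 2) → ∀ x : ℝ, ∃ v : ℤ → ℂ,
        (∀ k, ‖v k‖ ≤ K * (‖f (k + b)‖ * (1 / (1 + |x - b - k|)) ^ 2)) ∧ HasSum v (f x) := by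
  obtain ⟨K, hK, hKb⟩ := exists_norm_complexSinc_le
  refine ⟨2 * K ^ 2, by positivity, fun {f} hf {C} hC b hb x => ?_⟩
  have hC0 : 0 ≤ C := by simpa using (norm_nonneg _).trans (hC 0)
  -- The multiplier has type `π / 2`, using up the spare room below `π`. It equals `1` at `z = x -
  -- b` and supplies the decay on the real line that `f` need not have, as well as a second factor
  -- of decay in the kernel.
  set p : ℂ → ℂ := fun z => f (z + b) * complexSinc ((z + b - x) / 2) with hp
  have hpd : Differentiable ℂ p := by
    refine (hf.comp (differentiable_id.add_const _)).mul (differentiable_complexSinc.comp ?_)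
    exact ((differentiable_id.add_const _).sub_const _).div_const _
  have hSK : ∀ w : ℂ, ‖complexSinc w‖ ≤ K * Real.exp (Real.pi * |w.im|) := fun w =>
    (hKb w).trans (div_le_self (by positivity) (by linarith [norm_nonneg w]))
  have hpC : ∀ z, ‖p z‖ ≤ (C * K) * Real.exp (Real.pi * |z.im|) := by
    intro z
    have h1 := hC (z + b)
    have h2 := hSK ((z + b - x) / 2)
    have e1 : (z + b).im = z.im := by simp
    have e2 : ((z + b - x) / 2).im = z.im / 2 := by simp
    rw [e1] at h1
    rw [e2, abs_div, abs_two] at h2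
    calc ‖p z‖ ≤ (C * Real.exp (Real.pi / 2 * |z.im|))
          * (K * Real.exp (Real.pi * (|z.im| / 2))) := by
          rw [hp, norm_mul]; gcongr
      _ = C * K * (Real.exp (Real.pi / 2 * |z.im|) * Real.exp (Real.pi * (|z.im| / 2))) := by ring
      _ = _ := by rw [← Real.exp_add]; ring_nf
  have hps : Summable fun k : ℤ => ‖p k‖ ^ 2 := by
    refine Summable.of_nonneg_of_le (fun _ => by positivity) (fun k => ?_) (hb.mul_left (K ^ 2))
    have h2 := hSK (((k : ℂ) + b - x) / 2)
    have e2 : (((k : ℂ) + b - x) / 2).im = 0 := by simp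
    rw [e2, abs_zero, mul_zero, Real.exp_zero, mul_one] at h2
    rw [hp, norm_mul, mul_pow, mul_comm]
    gcongr
  have hpl : Tendsto (fun y : ℝ => p y) atTop (𝓝 0) := by
    have h1 : Tendsto (fun y : ℝ => (y + b - x) / 2) atTop atTop :=
      (tendsto_atTop_add_const_right _ _ (tendsto_atTop_add_const_right _ _
        tendsto_id)).atTop_div_const two_pos
    have h2 := ((tendsto_complexSinc_atTop.comp h1).norm).const_mul C
    rw [norm_zero, mul_zero] at h2
    refine squeeze_zero_norm (fun y => ?_) h2
    have h3 := hC (y + b)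
    have e1 : ((y : ℂ) + b).im = 0 := by simp
    rw [e1, abs_zero, mul_zero, Real.exp_zero, mul_one] at h3
    rw [hp, norm_mul, Function.comp_apply]
    push_cast
    gcongr
  have hz := eq_tsum_complexSinc hpd hpC hps hpl (x - b)
  have hpx : p (x - b) = f x := by simp [hp]
  refine ⟨fun k => p k * complexSinc (x - b - k), fun k => ?_, ?_⟩
  · have h1 := hKb (((k : ℂ) + b - x) / 2)
    have h2 := hKb ((x : ℂ) - b - k)
    have e1 : (((k : ℂ) + b - x) / 2).im = 0 := by simp
    have e2 : ((x : ℂ) - b - k).im = 0 := by simp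
    have n2 : ‖(x : ℂ) - b - k‖ = |x - b - k| := by
      rw [← Real.norm_eq_abs, ← Complex.norm_real]; push_cast; rfl
    have n1 : ‖((k : ℂ) + b - x) / 2‖ = |x - b - k| / 2 := by
      rw [← n2, norm_div, Complex.norm_ofNat, ← norm_neg]; ring_nf
    rw [e1, n1, abs_zero, mul_zero, Real.exp_zero, mul_one] at h1
    rw [e2, n2, abs_zero, mul_zero, Real.exp_zero, mul_one] at h2
    have h3 : K / (1 + |x - b - k| / 2) ≤ 2 * K * (1 / (1 + |x - b - k|)) := by
      rw [mul_one_div, div_le_div_iff₀ (by positivity) (by positivity)]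
      nlinarith [abs_nonneg (x - b - k)]
    calc ‖p k * complexSinc (x - b - k)‖
        = ‖f (k + b)‖ * ‖complexSinc (((k : ℂ) + b - x) / 2)‖ * ‖complexSinc ((x : ℂ) - b - k)‖ := by
          rw [norm_mul, hp, norm_mul]
      _ ≤ ‖f (k + b)‖ * (2 * K * (1 / (1 + |x - b - k|))) * (K / (1 + |x - b - k|)) := by
          gcongr; exact h1.trans h3
      _ = _ := by ring
  · rw [← hpx, hz]
    exact (summable_mul_complexSinc hps _).hasSum

/-- A Plancherel–Pólya inequality in qualitative form. -/
lemma summable_norm_sq_int_of_lintegral {f : ℂ → ℂ} (hf : Differentiable ℂ f) {C : ℝ}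
    (hC : ∀ z, ‖f z‖ ≤ C * Real.exp (Real.pi / 2 * |z.im|))
    (hL : ∫⁻ t : ℝ, ‖f t‖ₑ ^ 2 ≠ ⊤) : Summable fun m : ℤ => ‖f m‖ ^ 2 := by
  obtain ⟨b, hb⟩ := exists_tsum_translate_ne_top (φ := fun t : ℝ => ‖f t‖ₑ ^ 2)
    ((hf.continuous.comp Complex.continuous_ofReal).measurable.enorm.pow_const 2) hL
  have hbs : Summable fun k : ℤ => ‖f (k + b)‖ ^ 2 := by
    have h := ENNReal.summable_toReal hb
    simpa using h
  obtain ⟨K, hK, hKb⟩ := exists_norm_le_of_oversampling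
  obtain ⟨M, hM, hMb⟩ := exists_sum_inv_sq_le
  choose v hv hvs using fun m : ℤ => hKb hf hC b hbs m
  -- Schur's test: row and column sums of `d` are bounded by the same `M`, so the kernel acts
  -- boundedly on `ℓ²`.
  set d : ℤ → ℤ → ℝ := fun m k => (1 / (1 + |(m : ℝ) - b - k|)) ^ 2 with hd
  have hd0 : ∀ m k, 0 ≤ d m k := fun m k => by positivity
  have hdk : ∀ (m : ℤ) (s : Finset ℤ), ∑ k ∈ s, d m k ≤ M := fun m s => hMb (m - b) s
  have hdm : ∀ (k : ℤ) (t : Finset ℤ), ∑ m ∈ t, d m k ≤ M := by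
    intro k t
    refine le_trans (le_of_eq ?_) (hMb (b + k) t)
    refine Finset.sum_congr rfl fun m _ => ?_
    rw [hd, ← abs_neg]
    ring_nf
  have hrow : ∀ (m : ℤ) (s : Finset ℤ),
      ‖∑ k ∈ s, v m k‖ ^ 2 ≤ K ^ 2 * M * ∑ k ∈ s, ‖f (k + b)‖ ^ 2 * d m k := by
    intro m s
    have h1 : ‖∑ k ∈ s, v m k‖ ≤ K * ∑ k ∈ s, ‖f (k + b)‖ * d m k := by
      rw [Finset.mul_sum]
      exact norm_sum_le_of_le _ fun k _ => hv m k
    have h2 : (∑ k ∈ s, ‖f (k + b)‖ * d m k) ^ 2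
        ≤ (∑ k ∈ s, ‖f (k + b)‖ ^ 2 * d m k) * ∑ k ∈ s, d m k :=
      Finset.sum_sq_le_sum_mul_sum_of_sq_le_mul s (fun k _ => by have := hd0 m k; positivity)
        (fun k _ => hd0 m k) fun k _ => le_of_eq (by ring)
    have h3 : 0 ≤ ∑ k ∈ s, ‖f (k + b)‖ ^ 2 * d m k :=
      Finset.sum_nonneg fun k _ => mul_nonneg (by positivity) (hd0 m k)
    calc ‖∑ k ∈ s, v m k‖ ^ 2 ≤ (K * ∑ k ∈ s, ‖f (k + b)‖ * d m k) ^ 2 := by gcongr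
      _ = K ^ 2 * (∑ k ∈ s, ‖f (k + b)‖ * d m k) ^ 2 := by ring
      _ ≤ K ^ 2 * ((∑ k ∈ s, ‖f (k + b)‖ ^ 2 * d m k) * M) := by
        gcongr
        exact h2.trans (mul_le_mul_of_nonneg_left (hdk m s) h3)
      _ = _ := by ring
  refine summable_of_sum_le (c := K ^ 2 * M * (∑' k : ℤ, ‖f (k + b)‖ ^ 2 * M))
    (fun _ => by positivity) fun t => ?_
  -- With `t` fixed, the limit is taken in `s` only, so that just finite sums are interchanged.
  have hlim : Tendsto (fun s : Finset ℤ => ∑ m ∈ t, ‖∑ k ∈ s, v m k‖ ^ 2) atTop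
      (𝓝 (∑ m ∈ t, ‖f m‖ ^ 2)) :=
    tendsto_finsetSum _ fun m _ => by simpa using ((hvs m).norm.pow 2)
  refine le_of_tendsto' hlim fun s => ?_
  calc ∑ m ∈ t, ‖∑ k ∈ s, v m k‖ ^ 2
      ≤ ∑ m ∈ t, K ^ 2 * M * ∑ k ∈ s, ‖f (k + b)‖ ^ 2 * d m k :=
        Finset.sum_le_sum fun m _ => hrow m s
    _ = K ^ 2 * M * ∑ k ∈ s, ‖f (k + b)‖ ^ 2 * ∑ m ∈ t, d m k := by
        rw [← Finset.mul_sum, Finset.sum_comm]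
        simp_rw [Finset.mul_sum]
    _ ≤ K ^ 2 * M * ∑ k ∈ s, ‖f (k + b)‖ ^ 2 * M := by
        gcongr
        exact hdm _ t
    _ ≤ _ := by
        gcongr
        exact (hbs.mul_right M).sum_le_tsum s fun _ _ => by positivity

/-! ### Logarithmic coordinates -/

/-- The function `w ↦ g(e^w)` on the plane, for a function `g` on the Riemann surface of the
logarithm given by its sheets. -/
noncomputable def logSurfaceComp (G : ℤ → ℂ → ℂ) (Gp : ℤ → ℝ → ℂ) (w : ℂ) : ℂ :=
  if w.im = 2 * Real.pi * ⌊w.im / (2 * Real.pi)⌋ then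
    Gp ⌊w.im / (2 * Real.pi)⌋ (Real.exp w.re)
  else G ⌊w.im / (2 * Real.pi)⌋ (Complex.exp w)

lemma logSurfaceComp_of_im_eq (G : ℤ → ℂ → ℂ) (Gp : ℤ → ℝ → ℂ) {w : ℂ} {k : ℤ}
    (h : w.im = 2 * Real.pi * k) : logSurfaceComp G Gp w = Gp k (Real.exp w.re) := by
  have hk : ⌊w.im / (2 * Real.pi)⌋ = k := by
    rw [h, mul_div_cancel_left₀ _ (by positivity), Int.floor_intCast]
  rw [logSurfaceComp, hk, if_pos h]

lemma logSurfaceComp_of_im_mem_Ioo (G : ℤ → ℂ → ℂ) (Gp : ℤ → ℝ → ℂ) {w : ℂ} {k : ℤ}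
    (h : w.im ∈ Ioo (2 * Real.pi * k) (2 * Real.pi * (k + 1))) :
    logSurfaceComp G Gp w = G k (Complex.exp w) := by
  have hk : ⌊w.im / (2 * Real.pi)⌋ = k := by
    rw [Int.floor_eq_iff, le_div_iff₀ (by positivity), div_lt_iff₀ (by positivity)]
    constructor <;> linarith [h.1, h.2]
  rw [logSurfaceComp, hk, if_neg h.1.ne']

lemma exp_im_eq_mul_sin_sub (w : ℂ) (k : ℤ) :
    (Complex.exp w).im = Real.exp w.re * Real.sin (w.im - 2 * Real.pi * k) := by
  rw [Complex.exp_im, mul_comm (2 * Real.pi), Real.sin_sub_int_mul_two_pi]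

lemma exp_re_eq_mul_cos_sub (w : ℂ) (k : ℤ) :
    (Complex.exp w).re = Real.exp w.re * Real.cos (w.im - 2 * Real.pi * k) := by
  rw [Complex.exp_re, mul_comm (2 * Real.pi), Real.cos_sub_int_mul_two_pi]

lemma exp_mem_cutPlane {w : ℂ} {k : ℤ}
    (h : w.im ∈ Ioo (2 * Real.pi * k) (2 * Real.pi * (k + 1))) : Complex.exp w ∈ cutPlane := by
  rintro ⟨h1, h2⟩
  rw [exp_re_eq_mul_cos_sub w k] at h1
  rw [exp_im_eq_mul_sin_sub w k] at h2
  have he := Real.exp_pos w.re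
  have hs : Real.sin (w.im - 2 * Real.pi * k) = 0 := by simpa [he.ne'] using h2
  have hc : 0 ≤ Real.cos (w.im - 2 * Real.pi * k) := nonneg_of_mul_nonneg_right h1 he
  have hc1 : Real.cos (w.im - 2 * Real.pi * k) = 1 := by
    have := Real.sin_sq_add_cos_sq (w.im - 2 * Real.pi * k)
    rw [hs] at this
    nlinarith
  have h0 := (Real.cos_eq_one_iff_of_lt_of_lt (by linarith [h.1, Real.pi_pos])
    (by linarith [h.2])).mp hc1
  linarith [h.1]

lemma isOpen_cutPlane : IsOpen cutPlane := by
  have : cutPlane = {z : ℂ | 0 ≤ z.re ∧ z.im = 0}ᶜ := rfl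
  rw [this, isOpen_compl_iff]
  exact (isClosed_le continuous_const Complex.continuous_re).inter
    (isClosed_eq Complex.continuous_im continuous_const)

lemma IsLogSurfaceAnalytic.differentiable_logSurfaceComp {G : ℤ → ℂ → ℂ} {Gp Gm : ℤ → ℝ → ℂ}
    (h : IsLogSurfaceAnalytic G Gp Gm) : Differentiable ℂ (logSurfaceComp G Gp) := by
  intro w
  have hpi := Real.pi_pos
  set k := ⌊w.im / (2 * Real.pi)⌋ with hk
  have hk1 : 2 * Real.pi * k ≤ w.im := by
    have := Int.floor_le (w.im / (2 * Real.pi))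
    rw [le_div_iff₀ (by positivity)] at this
    linarith
  have hk2 : w.im < 2 * Real.pi * (k + 1) := by
    have := Int.lt_floor_add_one (w.im / (2 * Real.pi))
    rw [div_lt_iff₀ (by positivity)] at this
    linarith
  -- On the line `Im w = 2πk` sheet `k - 1` lies below and sheet `k` above, so the local model is
  -- `gluedBranch` with index `k - 1`; elsewhere it is `G k`.
  rcases hk1.eq_or_lt with hw | hw
  · have hx := Real.exp_pos w.re
    have hexp : Complex.exp w = (Real.exp w.re : ℝ) := by
      apply Complex.ext
      · rw [exp_re_eq_mul_cos_sub w k, hw, sub_self, Real.cos_zero, mul_one, Complex.ofReal_re]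
      · rw [exp_im_eq_mul_sin_sub w k, ← hw]; simp
    have hd : DifferentiableAt ℂ (gluedBranch G Gm (k - 1)) (Complex.exp w) := by
      refine (h.glue (k - 1) _ _ hx le_rfl).differentiableAt ?_
      rw [hexp]
      exact Metric.ball_mem_nhds _ hx
    refine DifferentiableAt.congr_of_eventuallyEq
      (hd.comp w Complex.differentiableAt_exp) ?_
    -- In this window `Im (exp u)` has the sign of `Im u - 2πk`.
    have hnhds : ∀ᶠ u : ℂ in 𝓝 w, u.im ∈ Ioo (w.im - Real.pi / 2) (w.im + Real.pi / 2) :=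
      Complex.continuous_im.continuousAt.eventually
        (Ioo_mem_nhds (by linarith) (by linarith))
    filter_upwards [hnhds] with u hu
    rw [← hw] at hu
    have hup := Real.exp_pos u.re
    have him := exp_im_eq_mul_sin_sub u k
    rw [Function.comp_apply, gluedBranch]
    rcases lt_trichotomy u.im (2 * Real.pi * k) with h1 | h1 | h1
    · have hlt : (Complex.exp u).im < 0 := by
        rw [him]
        exact mul_neg_of_pos_of_neg hup
          (Real.sin_neg_of_neg_of_neg_pi_lt (by linarith) (by linarith [hu.1]))
      rw [if_pos hlt]
      refine logSurfaceComp_of_im_mem_Ioo G Gp ⟨?_, ?_⟩ <;> push_cast <;> nlinarith [hu.1]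
    · have h0 : (Complex.exp u).im = 0 := by rw [him, h1]; simp
      have hre : (Complex.exp u).re = Real.exp u.re := by
        rw [exp_re_eq_mul_cos_sub u k, h1]; simp
      rw [if_neg (by rw [h0]; exact lt_irrefl 0), if_pos h0, hre, h.match_sheets _ _ hup,
        sub_add_cancel]
      exact logSurfaceComp_of_im_eq G Gp h1
    · have hgt : 0 < (Complex.exp u).im := by
        rw [him]
        exact mul_pos hup (Real.sin_pos_of_pos_of_lt_pi (by linarith) (by linarith [hu.2]))
      rw [if_neg hgt.not_gt, if_neg hgt.ne', sub_add_cancel]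
      refine logSurfaceComp_of_im_mem_Ioo G Gp ⟨h1, ?_⟩
      nlinarith [hu.2]
  · have hd : DifferentiableAt ℂ (G k) (Complex.exp w) :=
      (h.holo k).differentiableAt (isOpen_cutPlane.mem_nhds (exp_mem_cutPlane ⟨hw, hk2⟩))
    refine DifferentiableAt.congr_of_eventuallyEq
      (hd.comp w Complex.differentiableAt_exp) ?_
    filter_upwards [Complex.continuous_im.continuousAt.eventually (Ioo_mem_nhds hw hk2)] with u hu
    exact logSurfaceComp_of_im_mem_Ioo G Gp hu

lemma exists_logSurfaceComp_eq_branchValue (G : ℤ → ℂ → ℂ) (Gp Gm : ℤ → ℝ → ℂ) (w : ℂ) :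
    ∃ k : ℤ, ∃ θ ∈ Icc (0 : ℝ) (2 * Real.pi), w.im = 2 * Real.pi * k + θ ∧
      logSurfaceComp G Gp w = branchValue G Gp Gm k (Real.exp w.re) θ := by
  have hpi := Real.pi_pos
  set k := ⌊w.im / (2 * Real.pi)⌋ with hk
  have hk1 : 2 * Real.pi * k ≤ w.im := by
    have := Int.floor_le (w.im / (2 * Real.pi))
    rw [le_div_iff₀ (by positivity)] at this
    linarith
  have hk2 : w.im < 2 * Real.pi * (k + 1) := by
    have := Int.lt_floor_add_one (w.im / (2 * Real.pi))
    rw [div_lt_iff₀ (by positivity)] at this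
    linarith
  refine ⟨k, w.im - 2 * Real.pi * k, ⟨by linarith, by linarith⟩, by ring, ?_⟩
  rcases hk1.eq_or_lt with hw | hw
  · rw [logSurfaceComp_of_im_eq G Gp hw.symm, branchValue, if_pos (by linarith)]
  · rw [logSurfaceComp_of_im_mem_Ioo G Gp ⟨hw, hk2⟩, branchValue, if_neg (by linarith),
      if_neg (by linarith), Complex.ofReal_exp, ← Complex.exp_add]
    congr 1
    refine Complex.exp_eq_exp_iff_exists_int.mpr ⟨k, ?_⟩
    apply Complex.ext
    · simp
    · simp; ring

/-- Under `x = e^{t/s}` the Jacobian `x / s` turns the weight `x^{2c-1}` into `x^{2c} / s`. -/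
lemma MemX2.lintegral_comp_exp_ne_top {c : ℝ} {f : ℝ → ℂ} (hf : MemX2 c f) {s : ℝ} (hs : 0 < s) :
    ∫⁻ t : ℝ, ‖(((Real.exp (t / s)) ^ c : ℝ) : ℂ) * f (Real.exp (t / s))‖ₑ ^ 2 ≠ ⊤ := by
  have himg : (fun t : ℝ => Real.exp (t / s)) '' univ = Ioi 0 := by
    ext y
    simp only [image_univ, mem_range, mem_Ioi]
    refine ⟨by rintro ⟨t, rfl⟩; positivity, fun hy => ⟨s * Real.log y, ?_⟩⟩
    rw [mul_div_cancel_left₀ _ hs.ne', Real.exp_log hy]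
  have hder : ∀ t ∈ (univ : Set ℝ), HasDerivWithinAt (fun t : ℝ => Real.exp (t / s))
      (Real.exp (t / s) * (1 / s)) univ t := fun t _ =>
    ((hasDerivAt_id t).div_const s).exp.hasDerivWithinAt
  have hinj : InjOn (fun t : ℝ => Real.exp (t / s)) univ := by
    intro t _ u _ h
    have h1 := Real.exp_injective h
    field_simp at h1
    exact h1
  have h1 := lintegral_image_eq_lintegral_abs_deriv_mul MeasurableSet.univ hder hinj
    (fun x => ‖f x * ((x ^ (c - 1 / 2) : ℝ) : ℂ)‖ₑ ^ 2)
  rw [himg, setLIntegral_univ] at h1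
  have h2 : ∫⁻ x in Ioi (0 : ℝ), ‖f x * ((x ^ (c - 1 / 2) : ℝ) : ℂ)‖ₑ ^ 2 ≠ ⊤ := by
    have h3 := lintegral_rpow_enorm_lt_top_of_eLpNorm_lt_top (by norm_num) (by norm_num) hf.2
    simpa using h3.ne
  rw [h1] at h2
  have h4 : ∀ t : ℝ, ENNReal.ofReal |Real.exp (t / s) * (1 / s)|
        * ‖f (Real.exp (t / s)) * (((Real.exp (t / s)) ^ (c - 1 / 2) : ℝ) : ℂ)‖ₑ ^ 2
      = ENNReal.ofReal (1 / s)
        * ‖(((Real.exp (t / s)) ^ c : ℝ) : ℂ) * f (Real.exp (t / s))‖ₑ ^ 2 := by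
    intro t
    have he := Real.exp_pos (t / s)
    set y := Real.exp (t / s)
    have h5 : y * (y ^ (c - 1 / 2)) ^ 2 = (y ^ c) ^ 2 := by
      rw [← Real.rpow_mul_natCast he.le, ← Real.rpow_mul_natCast he.le]
      nth_rewrite 1 [← Real.rpow_one y]
      rw [← Real.rpow_add he]
      congr 1
      push_cast
      ring
    have hp1 : 0 < y ^ (c - 1 / 2) := by positivity
    have hp2 : 0 < y ^ c := by positivity
    rw [← ofReal_norm, ← ofReal_norm, ← ENNReal.ofReal_pow (norm_nonneg _),
      ← ENNReal.ofReal_pow (norm_nonneg _), ← ENNReal.ofReal_mul (by positivity),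
      ← ENNReal.ofReal_mul (by positivity), norm_mul, norm_mul, Complex.norm_real,
      Complex.norm_real, Real.norm_of_nonneg hp1.le, Real.norm_of_nonneg hp2.le,
      abs_of_pos (by positivity), mul_pow, mul_pow, ← h5]
    congr 1
    ring
  simp_rw [h4] at h2
  rw [lintegral_const_mul' _ _ ENNReal.ofReal_ne_top] at h2
  intro htop
  rw [htop, ENNReal.mul_top (by simpa using hs)] at h2
  exact h2 rfl

/-- In logarithmic coordinates a function of the Mellin–Bernstein space extends to an entire
function of exponential type. -/
lemma MemMellinBernstein.exists_entire {c T : ℝ} {f : ℝ → ℂ} (hf : MemMellinBernstein c T f) :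
    ∃ F : ℂ → ℂ, Differentiable ℂ F ∧
      (∃ C : ℝ, ∀ w, ‖F w‖ ≤ C * Real.exp (T * |w.im|)) ∧
      (∀ t : ℝ, F t = (((Real.exp t) ^ c : ℝ) : ℂ) * f (Real.exp t)) ∧
      Tendsto (fun t : ℝ => F t) atTop (𝓝 0) := by
  obtain ⟨-, G, Gp, Gm, hG, hGf, ⟨C, -, hC⟩, hlim⟩ := hf
  have hreal : ∀ t : ℝ, logSurfaceComp G Gp t = Gp 0 (Real.exp t) := fun t => by
    simpa using logSurfaceComp_of_im_eq G Gp (w := (t : ℂ)) (k := 0) (by simp)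
  refine ⟨logSurfaceComp G Gp, hG.differentiable_logSurfaceComp, ⟨C, fun w => ?_⟩, fun t => ?_, ?_⟩
  · obtain ⟨k, θ, hθ, him, hw⟩ := exists_logSurfaceComp_eq_branchValue G Gp Gm w
    rw [hw, him]
    exact hC k θ hθ _ (Real.exp_pos _)
  · rw [hreal, hGf _ (Real.exp_pos t)]
  · have h1 := ((hlim 0).2.tendsto_at (x := 0) ⟨le_rfl, by positivity⟩).comp
      Real.tendsto_exp_atTop
    refine h1.congr fun t => ?_
    rw [hreal, Function.comp_apply, branchValue, if_pos rfl]

/-- The factor `x^c` cancels `(x^σ)^{-c/σ}`; the remaining `e^{kc/σ}` is the weight of the sample at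
`e^{k/σ}`. -/
lemma rpow_mul_mul_mellinLin (c : ℝ) {σ : ℝ} (hσ : 0 < σ) (f : ℝ → ℂ) (k : ℤ) {x : ℝ}
    (hx : 0 < x) :
    ((x ^ c : ℝ) : ℂ) * (f (Real.exp ((k : ℝ) / σ)) *
        ((mellinLin (c / σ) (Real.exp (-(k : ℝ)) * x ^ σ) : ℝ) : ℂ))
      = (((Real.exp ((k : ℝ) / σ)) ^ c : ℝ) : ℂ) * f (Real.exp ((k : ℝ) / σ)) *
        complexSinc (((σ * Real.log x : ℝ) : ℂ) - k) := by
  have hy : 0 < x ^ σ := by positivity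
  have hlog : Real.log (Real.exp (-(k : ℝ)) * x ^ σ) = σ * Real.log x - k := by
    rw [Real.log_mul (Real.exp_ne_zero _) hy.ne', Real.log_exp, Real.log_rpow hx]
    ring
  have hpow : x ^ c * (Real.exp (-(k : ℝ)) * x ^ σ) ^ (-(c / σ))
      = (Real.exp ((k : ℝ) / σ)) ^ c := by
    rw [Real.mul_rpow (Real.exp_pos _).le hy.le, ← Real.rpow_mul hx.le,
      mul_neg, mul_div_cancel₀ _ hσ.ne', mul_left_comm, ← Real.rpow_add hx, add_neg_cancel,
      Real.rpow_zero, mul_one, ← Real.exp_mul, ← Real.exp_mul]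
    congr 1
    ring
  have hS : complexSinc (((σ * Real.log x : ℝ) : ℂ) - k)
      = (Real.sinc (Real.pi * (σ * Real.log x - k)) : ℝ) := by
    rw [← complexSinc_ofReal]
    push_cast
    rfl
  rw [hS, mellinLin, hlog, ← hpow]
  push_cast
  ring

/-! ### The exponential sampling formula -/

theorem theorem7 (c σ : ℝ) (hσ : 0 < σ) (f : ℝ → ℂ)
    (hf : MemMellinBernstein c (Real.pi * σ) f) :
    TendstoUniformlyOn
      (fun (s : Finset ℤ) (x : ℝ) => ((x ^ c : ℝ) : ℂ) *
        ∑ k ∈ s, f (Real.exp ((k : ℝ) / σ)) *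
          ((mellinLin (c / σ) (Real.exp (-(k : ℝ)) * x ^ σ) : ℝ) : ℂ))
      (fun x : ℝ => ((x ^ c : ℝ) : ℂ) * f x) atTop (Ioi 0) ∧
    ∀ x : ℝ, 0 < x →
      HasSum (fun k : ℤ => f (Real.exp ((k : ℝ) / σ)) *
        ((mellinLin (c / σ) (Real.exp (-(k : ℝ)) * x ^ σ) : ℝ) : ℂ)) (f x) := by
  obtain ⟨F, hFd, ⟨C, hFC⟩, hFf, hFlim⟩ := hf.exists_entire
  set H : ℂ → ℂ := fun z => F (z / σ) with hH
  have hσ' : (σ : ℂ) ≠ 0 := by exact_mod_cast hσ.ne'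
  have him : ∀ (z : ℂ) {r : ℝ}, 0 < r → |(z / (r : ℂ)).im| = |z.im| / r := fun z r hr => by
    rw [Complex.div_ofReal_im, abs_div, abs_of_pos hr]
  have hHd : Differentiable ℂ H := hFd.comp (differentiable_id.div_const _)
  have hHC : ∀ z, ‖H z‖ ≤ C * Real.exp (Real.pi * |z.im|) := by
    intro z
    have h1 := hFC (z / σ)
    rw [him z hσ, mul_assoc, mul_div_cancel₀ _ hσ.ne'] at h1
    exact h1
  have hHreal : ∀ t : ℝ, H t
      = (((Real.exp (t / σ)) ^ c : ℝ) : ℂ) * f (Real.exp (t / σ)) := by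
    intro t
    rw [← hFf, hH]
    push_cast
    rfl
  have hHlim : Tendsto (fun x : ℝ => H x) atTop (𝓝 0) := by
    refine (hFlim.comp (tendsto_id.atTop_div_const hσ)).congr fun t => ?_
    simp [hH]
  -- Dilation by `2` lowers the type to `π / 2`, as oversampling requires; the integer samples of
  -- `H` are then those with even `m`.
  have hhalf : Summable fun m : ℤ => ‖H (m / 2)‖ ^ 2 := by
    refine summable_norm_sq_int_of_lintegral (f := fun z => H (z / 2)) (C := C)
      (hHd.comp (differentiable_id.div_const _)) (fun z => ?_) ?_
    · have h1 := hHC (z / 2)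
      have h2 := him z two_pos
      push_cast at h2
      rw [h2, mul_div_assoc', mul_div_right_comm] at h1
      exact h1
    · have h1 := hf.1.lintegral_comp_exp_ne_top (s := 2 * σ) (by positivity)
      convert h1 using 5 with t
      have h2 := hHreal (t / 2)
      rw [div_div] at h2
      rw [← h2]
      push_cast
      rfl
  have hsum : Summable fun k : ℤ => ‖H k‖ ^ 2 := by
    have h1 := hhalf.comp_injective (i := fun k : ℤ => 2 * k)
      (fun a b h => mul_left_cancel₀ two_ne_zero h)
    refine h1.congr fun k => ?_
    simp
  have hterm : ∀ (k : ℤ) {x : ℝ}, 0 < x →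
      ((x ^ c : ℝ) : ℂ) * (f (Real.exp ((k : ℝ) / σ)) *
        ((mellinLin (c / σ) (Real.exp (-(k : ℝ)) * x ^ σ) : ℝ) : ℂ))
      = H k * complexSinc (((σ * Real.log x : ℝ) : ℂ) - k) := by
    intro k x hx
    rw [rpow_mul_mul_mellinLin c hσ f k hx, ← hHreal]
    push_cast
    rfl
  have hval : ∀ {x : ℝ}, 0 < x → ((x ^ c : ℝ) : ℂ) * f x
      = ∑' k : ℤ, H k * complexSinc (((σ * Real.log x : ℝ) : ℂ) - k) := by
    intro x hx
    rw [← eq_tsum_complexSinc hHd hHC hsum hHlim, hHreal, mul_div_cancel_left₀ _ hσ.ne',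
      Real.exp_log hx]
  refine ⟨?_, fun x hx => ?_⟩
  · rw [Metric.tendstoUniformlyOn_iff]
    intro ε hε
    filter_upwards [Metric.tendstoUniformlyOn_iff.mp
      (tendstoUniformlyOn_sum_complexSinc hsum 1) ε hε] with s hs x hx
    rw [hval hx, Finset.mul_sum, Finset.sum_congr rfl fun k _ => hterm k hx]
    exact hs _ (by simp)
  · have hxc : ((x ^ c : ℝ) : ℂ) ≠ 0 := by
      exact_mod_cast (Real.rpow_pos_of_pos hx c).ne'
    refine (hasSum_mul_left_iff hxc).mp ?_
    simp_rw [hterm _ hx, hval hx]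
    exact (summable_mul_complexSinc hsum _).hasSum
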